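/- **Key-Lemma.** For a simplicial set $X$ and a simplex $\sigma\in X_m$, let $X_{\sigma/}$ be the simplicial set whose $l$-simplices are the maps $\Delta^{m+l+1}\to X$ restricting to $\sigma$ on $[0,\dots,m]$, where simplicial operators act on the last $l+1$ vertices; restriction to $[m+1,\dots,m+l+1]$ defines a projection $X_{\sigma/}\to X$. For a map of simplicial sets $p:X\to Y$ and $\sigma\in Y_m$ let $p_{|\sigma}:X_{|\sigma}=X\times_Y\Delta^m\to\Delta^m$ be the pullback of $p$ along $\sigma$. An edge $f:x\to y$ of $X$ is *$p$-coCartesian* if $X_{f/}\to X_{x/}\times_{Y_{p(x)/}}Y_{p(f)/}$ is a trivial Kan fibration, i.e. has the right lifting property with respect to $\partial\Delta^l\subset\Delta^l$ for all $l\ge 0$. It is *locally $p$-coCartesian* if, with $\sigma=p(f)$, the edge $(f,\mathrm{id}_{\Delta^1})$ of $X_{|\sigma}$ is $p_{|\sigma}$-coCartesian. The map $p$ is a *locally coCartesian fibration* if it is an inner fibration and for every edge $e:\bar x\to\bar y$ of $Y$ and every vertex $x$ of $X$ with $p(x)=\bar x$ there is a locally $p$-coCartesian edge $f$ of $X$ with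 source $x$ and $p(f)=e$. Let $n\ge 0$, let $p:X\to\Delta^n$ be a locally coCartesian fibration of simplicial sets, let $x\in X_0$ be a vertex, and let $X_{|n}$ be the fibre of $p$ over the last vertex $n$ of $\Delta^n$. Then the simplicial set $X_{|n}\times_X X_{x/}$ is weakly contractible, i.e. its geometric realisation is non-empty and all its homotopy groups (including $\pi_0$), at every base point, are trivial. -/

import Mathlib

open CategoryTheory Limits Simplicial Opposite Topology

universe u

namespace LocCoCart

/-- The underlying map of the join `θ ⋆ φ : ⦋a⦌ ⋆ ⦋c⦌ ⟶ ⦋b⦌ ⋆ ⦋d⦌`, where `⦋a⦌ ⋆ ⦋c⦌ = ⦋a + 1 + c⦌`: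
the first `a + 1` vertices are mapped by `θ`, the last `c + 1` by `φ`. -/
def joinFun {a b c d : SimplexCategory} (θ : a ⟶ b) (φ : c ⟶ d) :
    Fin ((a.len + 1) + (c.len + 1)) → Fin ((b.len + 1) + (d.len + 1)) :=
  Fin.addCases (fun i => Fin.castAdd (d.len + 1) (θ.toOrderHom i))
    (fun j => Fin.natAdd (b.len + 1) (φ.toOrderHom j))

@[simp]
lemma joinFun_castAdd {a b c d : SimplexCategory} (θ : a ⟶ b) (φ : c ⟶ d) (i : Fin (a.len + 1)) :
    joinFun θ φ (Fin.castAdd _ i) = Fin.castAdd _ (θ.toOrderHom i) := by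
  simp [joinFun]

@[simp]
lemma joinFun_natAdd {a b c d : SimplexCategory} (θ : a ⟶ b) (φ : c ⟶ d) (j : Fin (c.len + 1)) :
    joinFun θ φ (Fin.natAdd _ j) = Fin.natAdd _ (φ.toOrderHom j) := by
  simp [joinFun]

lemma joinFun_monotone {a b c d : SimplexCategory} (θ : a ⟶ b) (φ : c ⟶ d) :
    Monotone (joinFun θ φ) := by
  intro i j
  refine Fin.addCases (fun i => ?_) (fun i => ?_) i <;>
    refine Fin.addCases (fun j => ?_) (fun j => ?_) j <;> intro h
  · simp only [joinFun_castAdd]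
    have := θ.toOrderHom.monotone (a := i) (b := j) (by
      rw [Fin.le_def] at h ⊢
      simpa using h)
    rw [Fin.le_def] at this ⊢
    simpa using this
  · simp only [joinFun_castAdd, joinFun_natAdd, Fin.le_def, Fin.val_castAdd, Fin.val_natAdd]
    have := (θ.toOrderHom i).isLt
    omega
  · simp only [Fin.le_def, Fin.val_castAdd, Fin.val_natAdd] at h
    have := j.isLt
    omega
  · simp only [joinFun_natAdd]
    have := φ.toOrderHom.monotone (a := i) (b := j) (by
      rw [Fin.le_def] at h ⊢
      simpa using h)
    rw [Fin.le_def] at this ⊢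
    simpa using this

/-- The join `⦋a⦌ ⋆ ⦋c⦌ = ⦋a + 1 + c⦌` of two objects of the simplex category. -/
abbrev joinObj (a c : SimplexCategory) : SimplexCategory := ⦋a.len + 1 + c.len⦌

/-- The join of two morphisms of the simplex category. -/
def joinMap {a b c d : SimplexCategory} (θ : a ⟶ b) (φ : c ⟶ d) : joinObj a c ⟶ joinObj b d :=
  SimplexCategory.Hom.mk ⟨joinFun θ φ, joinFun_monotone θ φ⟩

/-- The inclusion of the front face `[0, …, a]` in `[0, …, a + 1 + c]`. -/
def joinInl (a c : SimplexCategory) : a ⟶ joinObj a c :=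
  SimplexCategory.Hom.mk
    ⟨fun i => (Fin.castAdd (c.len + 1) i : Fin ((a.len + 1) + (c.len + 1))),
      fun i j h => by
        rw [Fin.le_def] at h ⊢
        simpa using h⟩

/-- The inclusion of the back face `[a + 1, …, a + 1 + c]` in `[0, …, a + 1 + c]`. -/
def joinInr (a c : SimplexCategory) : c ⟶ joinObj a c :=
  SimplexCategory.Hom.mk
    ⟨fun i => (Fin.natAdd (a.len + 1) i : Fin ((a.len + 1) + (c.len + 1))),
      fun i j h => by
        rw [Fin.le_def] at h ⊢
        simpa using h⟩

lemma joinMap_id (a c : SimplexCategory) : joinMap (𝟙 a) (𝟙 c) = 𝟙 (joinObj a c) := by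
  ext i : 3
  change joinFun (𝟙 a) (𝟙 c) i = i
  refine Fin.addCases (m := a.len + 1) (n := c.len + 1) (fun i => ?_) (fun i => ?_) i <;> simp

lemma joinMap_comp {a₁ a₂ a₃ c₁ c₂ c₃ : SimplexCategory} (θ : a₁ ⟶ a₂) (θ' : a₂ ⟶ a₃)
    (φ : c₁ ⟶ c₂) (φ' : c₂ ⟶ c₃) :
    joinMap (θ ≫ θ') (φ ≫ φ') = joinMap θ φ ≫ joinMap θ' φ' := by
  ext i : 3
  change joinFun (θ ≫ θ') (φ ≫ φ') i = joinFun θ' φ' (joinFun θ φ i)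
  refine Fin.addCases (m := a₁.len + 1) (n := c₁.len + 1) (fun i => ?_) (fun i => ?_) i <;> simp

lemma joinInl_joinMap {a b c d : SimplexCategory} (θ : a ⟶ b) (φ : c ⟶ d) :
    joinInl a c ≫ joinMap θ φ = θ ≫ joinInl b d := by
  ext i : 3
  exact joinFun_castAdd θ φ i

lemma joinInr_joinMap {a b c d : SimplexCategory} (θ : a ⟶ b) (φ : c ⟶ d) :
    joinInr a c ≫ joinMap θ φ = φ ≫ joinInr b d := by
  ext i : 3
  exact joinFun_natAdd θ φ i

lemma map_map_apply {X : SSet.{u}} {a b c : SimplexCategory} (f : a ⟶ b) (g : b ⟶ c)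
    (x : X.obj (op c)) : X.map f.op (X.map g.op x) = X.map (f ≫ g).op x := by
  rw [op_comp, X.map_comp]
  rfl

/-- The under-category `X_{σ/}` of a simplicial set `X` at a simplex `σ` of dimension `a`: its
`c`-simplices are the simplices of `X` of dimension `a + 1 + c` whose front `a`-face is `σ`, and a
simplicial operator `φ` acts on them through `𝟙 ⋆ φ`. -/
def under (X : SSet.{u}) {a : SimplexCategory} (σ : X.obj (op a)) : SSet.{u} where
  obj c := { f : X.obj (op (joinObj a c.unop)) // X.map (joinInl a c.unop).op f = σ }
  map {c d} φ := TypeCat.ofHom fun f => ⟨X.map (joinMap (𝟙 a) φ.unop).op f.1, by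
    rw [map_map_apply, joinInl_joinMap, Category.id_comp, f.2]⟩
  map_id c := by
    ext f
    change X.map (joinMap (𝟙 a) (𝟙 c.unop)).op f.1 = f.1
    rw [joinMap_id, op_id, X.map_id]
    rfl
  map_comp {c d e} φ ψ := by
    ext f
    change X.map (joinMap (𝟙 a) (ψ.unop ≫ φ.unop)).op f.1 =
      X.map (joinMap (𝟙 a) ψ.unop).op (X.map (joinMap (𝟙 a) φ.unop).op f.1)
    rw [map_map_apply, ← joinMap_comp, Category.id_comp]

/-- The projection `X_{σ/} ⟶ X`, restricting a simplex to its back face. -/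
def underProj (X : SSet.{u}) {a : SimplexCategory} (σ : X.obj (op a)) : under X σ ⟶ X where
  app c := TypeCat.ofHom fun f => X.map (joinInr a c.unop).op f.1
  naturality {c d} φ := by
    ext f
    change X.map (joinInr a d.unop).op (X.map (joinMap (𝟙 a) φ.unop).op f.1) =
      X.map φ.unop.op (X.map (joinInr a c.unop).op f.1)
    rw [map_map_apply, map_map_apply, joinInr_joinMap]

/-- The map `X_{σ/} ⟶ X_{τ/}` given by restriction along `θ`, where `τ = θ^* σ`. -/
def underRestrict (X : SSet.{u}) {a b : SimplexCategory} (θ : b ⟶ a) {σ : X.obj (op a)}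
    {τ : X.obj (op b)} (h : X.map θ.op σ = τ) : under X σ ⟶ under X τ where
  app c := TypeCat.ofHom fun f => ⟨X.map (joinMap θ (𝟙 c.unop)).op f.1, by
    rw [map_map_apply, joinInl_joinMap, ← map_map_apply, f.2, h]⟩
  naturality {c d} φ := by
    ext f
    apply Subtype.ext
    change X.map (joinMap θ (𝟙 d.unop)).op (X.map (joinMap (𝟙 a) φ.unop).op f.1) =
      X.map (joinMap (𝟙 b) φ.unop).op (X.map (joinMap θ (𝟙 c.unop)).op f.1)
    rw [map_map_apply, map_map_apply, ← joinMap_comp, ← joinMap_comp]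
    simp only [Category.id_comp, Category.comp_id]

/-- The map `X_{σ/} ⟶ Y_{τ/}` induced by `p : X ⟶ Y`, where `τ = p σ`. -/
def underMap {X Y : SSet.{u}} (p : X ⟶ Y) {a : SimplexCategory} {σ : X.obj (op a)}
    {τ : Y.obj (op a)} (h : p.app _ σ = τ) : under X σ ⟶ under Y τ where
  app c := TypeCat.ofHom fun f => ⟨p.app _ f.1, by
    rw [← NatTrans.naturality_apply, f.2, h]⟩
  naturality {c d} φ := by
    ext f
    apply Subtype.ext
    exact NatTrans.naturality_apply p (joinMap (𝟙 a) φ.unop).op f.1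

/-- The vertex `⦋0⦌ ⟶ ⦋1⦌` with value `0`. -/
abbrev sourceVertex : ⦋0⦌ ⟶ ⦋1⦌ := SimplexCategory.δ 1

/-- The source `x` of an edge `f : x ⟶ y`. -/
abbrev source {X : SSet.{u}} (f : X _⦋1⦌) : X _⦋0⦌ := X.map sourceVertex.op f

lemma source_app {X Y : SSet.{u}} (p : X ⟶ Y) (f : X _⦋1⦌) :
    p.app _ (source f) = source (p.app _ f) :=
  NatTrans.naturality_apply p sourceVertex.op f

lemma underMap_underRestrict {X Y : SSet.{u}} (p : X ⟶ Y) (f : X _⦋1⦌) :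
    underRestrict X sourceVertex (rfl : _ = source f) ≫ underMap p (source_app p f) =
      underMap p rfl ≫ underRestrict Y sourceVertex (rfl : _ = source (p.app _ f)) := by
  ext c g
  apply Subtype.ext
  exact NatTrans.naturality_apply p (joinMap sourceVertex (𝟙 c.unop)).op g.1

/-- The canonical map `X_{f/} ⟶ X_{x/} ×_{Y_{p(x)/}} Y_{p(f)/}` attached to an edge `f : x ⟶ y`
of `X`. -/
noncomputable def coCartesianComparison {X Y : SSet.{u}} (p : X ⟶ Y) (f : X _⦋1⦌) :
    under X f ⟶ pullback (underMap p (source_app p f))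
      (underRestrict Y sourceVertex (rfl : _ = source (p.app _ f))) :=
  pullback.lift (underRestrict X sourceVertex rfl) (underMap p rfl) (underMap_underRestrict p f)

/-- Trivial Kan fibrations: the right lifting property with respect to `∂Δ[n] ⟶ Δ[n]`, `n ≥ 0`. -/
def IsTrivialKanFibration {X Y : SSet.{u}} (p : X ⟶ Y) : Prop :=
  ∀ n : ℕ, HasLiftingProperty (SSet.boundary.{u} n).ι p

/-- An edge `f : x ⟶ y` of `X` is `p`-coCartesian if
`X_{f/} ⟶ X_{x/} ×_{Y_{p(x)/}} Y_{p(f)/}` is a trivial Kan fibration. -/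
def IsCoCartesianEdge {X Y : SSet.{u}} (p : X ⟶ Y) (f : X _⦋1⦌) : Prop :=
  IsTrivialKanFibration (coCartesianComparison p f)

/-- The simplicial set `X_{|σ} = X ×_Y Δ[n]` for a simplex `σ` of `Y`. -/
noncomputable abbrev restr {X Y : SSet.{u}} (p : X ⟶ Y) {n : ℕ} (σ : Y _⦋n⦌) : SSet.{u} :=
  pullback p (SSet.yonedaEquiv.symm σ)

/-- The map `p_{|σ} : X_{|σ} ⟶ Δ[n]`. -/
noncomputable abbrev restrMap {X Y : SSet.{u}} (p : X ⟶ Y) {n : ℕ} (σ : Y _⦋n⦌) :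
    restr p σ ⟶ Δ[n] :=
  pullback.snd p (SSet.yonedaEquiv.symm σ)

/-- The canonical projection `X_{|σ} ⟶ X`. -/
noncomputable abbrev restrProj {X Y : SSet.{u}} (p : X ⟶ Y) {n : ℕ} (σ : Y _⦋n⦌) :
    restr p σ ⟶ X :=
  pullback.fst p (SSet.yonedaEquiv.symm σ)

/-- A simplex `f` of `X`, viewed as the simplex `(f, 𝟙)` of `X_{|σ}`, `σ = p f`. -/
noncomputable def liftRestr {X Y : SSet.{u}} (p : X ⟶ Y) {n : ℕ} (f : X _⦋n⦌) :
    (restr p (p.app _ f)) _⦋n⦌ :=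
  SSet.yonedaEquiv (pullback.lift (SSet.yonedaEquiv.symm f) (𝟙 Δ[n])
    (by rw [SSet.yonedaEquiv_symm_comp, Category.id_comp]))

/-- An edge `f` of `X` is locally `p`-coCartesian if it is a coCartesian edge for
`p_{|σ} : X_{|σ} ⟶ Δ[1]`, where `σ = p f`. -/
def IsLocallyCoCartesianEdge {X Y : SSet.{u}} (p : X ⟶ Y) (f : X _⦋1⦌) : Prop :=
  IsCoCartesianEdge (restrMap p (p.app _ f)) (liftRestr p f)

/-- Locally coCartesian fibrations of simplicial sets: inner fibrations `p : X ⟶ Y` such that every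
edge `e` of `Y` has a locally `p`-coCartesian lift with any prescribed source over the source
of `e`. -/
structure IsLocallyCoCartesianFibration {X Y : SSet.{u}} (p : X ⟶ Y) : Prop where
  innerFibration : SSet.InnerFibration p
  exists_lift : ∀ (e : Y _⦋1⦌) (x : X _⦋0⦌), p.app _ x = source e →
    ∃ f : X _⦋1⦌, source f = x ∧ p.app _ f = e ∧ IsLocallyCoCartesianEdge p f

/-- A simplicial set is weakly contractible if its geometric realisation is weakly homotopy
equivalent to a point: it is non-empty and its homotopy groups `π_ k`, including the set `π_ 0` of
path components, are trivial at every base point. -/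
def IsWeaklyContractible (X : SSet.{u}) : Prop :=
  Nonempty (SSet.toTop.obj X) ∧
    ∀ (k : ℕ) (x : SSet.toTop.obj X), Subsingleton (π_ k (SSet.toTop.obj X) x)

/-- The last vertex `n` of `Δ[n]`. -/
def lastVertex (n : ℕ) : (Δ[n] : SSet.{u}) _⦋0⦌ := SSet.stdSimplex.obj₀Equiv.symm (Fin.last n)

end LocCoCart

/-! Choose a locally coCartesian lift `f : x ⟶ y` of the edge `σ` from `p x` to `n` (degenerate if
`p x = n`), and put `Z = X_{|σ}` with its map `q` to `Δ[1]`. The simplicial set in question is a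
retract of the part `S` of `Z_{x/}` over the vertex `1`
(`fibreUnderToOverOne_comp_overOneToFibreUnder`), so it suffices to contract `|S|`.

The edge `f` is a vertex `v` of `S`, and being coCartesian makes it behave like an initial object.
Indeed `Δ[1]_{τ/}` is a point for the tautological edge `τ`, so the trivial fibration attached to
`f` lifts `S ⊂ Z_{x/}` to a map `S ⟶ Z_{f/}`. A simplex `(x, y, z₀, …, z_l)` of `Z_{f/}` can be read
as a simplex of `S_{v/}`, which gives a section of `S_{v/} ⟶ S`
(`IsCoCartesianEdge.contractibleSpace_overOne`).

Such a section cones off all simplices of `S` compatibly with the simplicial operators, and the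
straight lines in these cones contract `|S|` to `v` (`contractibleSpace_of_section`). Triviality of
the homotopy groups then follows from `HomotopyGroup.subsingleton_of_contractibleSpace`, where the
contraction may move the base point. -/

namespace Cube

/-! ### Homotopy groups of contractible spaces. -/

open unitInterval

/-- Rescaling the cube around its centre by the factor `1 + t`, clamped to the cube. -/
noncomputable def dilate {N : Type*} (t : ℝ) (y : N → I) : N → I :=
  fun i => Set.projIcc 0 1 zero_le_one ((1 + t) * (y i : ℝ) - t / 2)

@[simp]
lemma dilate_zero {N : Type*} (y : N → I) : dilate 0 y = y := by
  ext i
  simp [dilate]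

lemma dilate_mem_boundary {N : Type*} {t : ℝ} (ht : 0 ≤ t) {y : N → I} (hy : y ∈ Cube.boundary N) :
    dilate t y ∈ Cube.boundary N := by
  obtain ⟨i, hi | hi⟩ := hy
  · refine ⟨i, Or.inl (Set.projIcc_of_le_left _ ?_)⟩
    simp only [hi, Set.Icc.coe_zero]
    linarith
  · refine ⟨i, Or.inr (Set.projIcc_of_right_le _ ?_)⟩
    simp only [hi, Set.Icc.coe_one]
    linarith

/-- At `t = 1` the coordinate becomes `2 y - 1/2`, clamped: the subcube `[1/4, 3/4]^N` fills the
cube and everything else is pushed to the boundary. -/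
lemma dilate_one_mem_boundary {N : Type*} {y : N → I} {i : N}
    (hi : (y i : ℝ) ≤ 1 / 4 ∨ 3 / 4 ≤ (y i : ℝ)) : dilate 1 y ∈ Cube.boundary N := by
  refine ⟨i, hi.imp (fun h => Set.projIcc_of_le_left _ ?_)
    (fun h => Set.projIcc_of_right_le _ ?_)⟩ <;> linarith

lemma continuous_dilate {N : Type*} : Continuous fun z : ℝ × (N → I) => dilate z.1 z.2 := by
  refine continuous_pi fun i => continuous_projIcc.comp ?_
  fun_prop

/-- A bump function on the cube, vanishing on the boundary and equal to `1` on the concentric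
subcube `[1/4, 3/4]^N`. -/
noncomputable def bump {N : Type*} [Fintype N] (y : N → I) : I :=
  Finset.univ.inf fun i =>
    Set.projIcc (0 : ℝ) 1 zero_le_one (4 * min (y i : ℝ) (1 - y i))

lemma continuous_bump {N : Type*} [Fintype N] : Continuous (bump (N := N)) := by
  refine Continuous.finset_inf_apply fun i _ => continuous_projIcc.comp ?_
  fun_prop

lemma bump_of_mem_boundary {N : Type*} [Fintype N] {y : N → I} (hy : y ∈ Cube.boundary N) :
    bump y = 0 := by
  obtain ⟨i, hi⟩ := hy
  refine le_antisymm ((Finset.inf_le (Finset.mem_univ i)).trans (le_of_eq ?_)) unitInterval.nonneg'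
  refine Set.projIcc_of_le_left _ ?_
  rcases hi with hi | hi <;> simp [hi]

lemma bump_eq_one {N : Type*} [Fintype N] {y : N → I}
    (hy : ∀ i, 1 / 4 ≤ (y i : ℝ) ∧ (y i : ℝ) ≤ 3 / 4) : bump y = 1 := by
  refine le_antisymm unitInterval.le_one' (Finset.le_inf fun i _ => le_of_eq ?_)
  refine (Set.projIcc_of_right_le _ ?_).symm
  have : 1 / 4 ≤ min (y i : ℝ) (1 - y i) := le_min (hy i).1 (by linarith [(hy i).2])
  linarith

end Cube

open unitInterval in
/-- The homotopy groups of a contractible space are trivial. -/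
theorem HomotopyGroup.subsingleton_of_contractibleSpace (N : Type*) [Fintype N] (X : Type*)
    [TopologicalSpace X] [ContractibleSpace X] (x : X) : Subsingleton (HomotopyGroup N X x) := by
  obtain ⟨c, ⟨H⟩⟩ := id_nullhomotopic X
  -- The common representative of all classes: run along the track of `x` under the contraction,
  -- from `x` on the boundary to `c` on the inner subcube.
  let loop : GenLoop N X x := ⟨⟨fun y => H (Cube.bump y, x),
    H.continuous.comp (Cube.continuous_bump.prodMk continuous_const)⟩, fun y hy => by
      simp [Cube.bump_of_mem_boundary hy]⟩
  suffices h : ∀ f : GenLoop N X x, GenLoop.Homotopic f loop by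
    refine ⟨fun a b => Quotient.inductionOn₂ a b fun f g => Quotient.sound ((h f).trans (h g).symm)⟩
  intro f
  -- First concentrate `f` on the inner subcube, leaving a collar on which it is constantly `x`; the
  -- collar absorbs the motion of the base point.
  have hf₁ : Continuous fun y => f (Cube.dilate 1 y) :=
    f.1.continuous.comp (Cube.continuous_dilate.comp (continuous_const.prodMk continuous_id))
  let f₁ : GenLoop N X x := ⟨⟨fun y => f (Cube.dilate 1 y), hf₁⟩,
    fun y hy => f.2 _ (Cube.dilate_mem_boundary zero_le_one hy)⟩
  have h₁ : GenLoop.Homotopic f f₁ := ⟨{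
    toFun z := f (Cube.dilate z.1 z.2)
    continuous_toFun := f.1.continuous.comp (Cube.continuous_dilate.comp
      ((continuous_subtype_val.comp continuous_fst).prodMk continuous_snd))
    map_zero_left y := by simp
    map_one_left y := by simp [f₁]
    prop' t y hy := (f.2 _ (Cube.dilate_mem_boundary t.2.1 hy)).trans (f.2 y hy).symm }⟩
  refine h₁.trans ⟨{
    -- Cutting the time off by the bump keeps the homotopy fixed on the boundary.
    toFun z := H (z.1 ⊓ Cube.bump z.2, f (Cube.dilate 1 z.2))
    continuous_toFun := H.continuous.comp <| Continuous.prodMk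
      (continuous_fst.inf (Cube.continuous_bump.comp continuous_snd)) (hf₁.comp continuous_snd)
    map_zero_left y := ?_
    map_one_left y := ?_
    prop' t y hy := ?_ }⟩
  · simp [f₁]
  · have h1 : (1 : I) ⊓ Cube.bump y = Cube.bump y := min_eq_right unitInterval.le_one'
    change H ((1 : I) ⊓ Cube.bump y, _) = H (Cube.bump y, x)
    rw [h1]
    -- On the inner subcube both sides have reached `c`; outside it the dilated `f` equals `x`.
    by_cases hy : ∀ i, 1 / 4 ≤ (y i : ℝ) ∧ (y i : ℝ) ≤ 3 / 4
    · rw [Cube.bump_eq_one hy, H.apply_one, H.apply_one]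
      rfl
    · push Not at hy
      obtain ⟨i, hi⟩ := hy
      have hb : Cube.dilate 1 y ∈ Cube.boundary N :=
        Cube.dilate_one_mem_boundary (i := i) (by
          by_cases h : (y i : ℝ) ≤ 1 / 4
          · exact Or.inl h
          · exact Or.inr (hi (by linarith)).le)
      exact congrArg (fun a => H (Cube.bump y, a)) (f.2 _ hb)
  · have h0 : t ⊓ Cube.bump y = 0 := by
      rw [Cube.bump_of_mem_boundary hy]
      exact min_eq_right unitInterval.nonneg'
    change H (t ⊓ Cube.bump y, f (Cube.dilate 1 y)) = f (Cube.dilate 1 y)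
    rw [h0, H.apply_zero]
    rfl

/-! ### Line segments in topological simplices. -/

/-- The point `(1 - t) • a + t • b` of the standard simplex. -/
noncomputable def stdSimplex.segment {ι : Type*} [Fintype ι] (a b : stdSimplex ℝ ι)
    (t : unitInterval) : stdSimplex ℝ ι :=
  ⟨(1 - (t : ℝ)) • a.1 + (t : ℝ) • b.1,
    convex_stdSimplex ℝ ι a.2 b.2 (sub_nonneg.2 t.2.2) t.2.1 (by ring)⟩

namespace stdSimplex

variable {ι κ : Type*} [Fintype ι] [Fintype κ]

@[simp]
lemma segment_zero (a b : stdSimplex ℝ ι) : segment a b 0 = a := by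
  ext i
  simp [segment]

@[simp]
lemma segment_one (a b : stdSimplex ℝ ι) : segment a b 1 = b := by
  ext i
  simp [segment]

lemma map_segment (f : ι → κ) (a b : stdSimplex ℝ ι) (t : unitInterval) :
    map f (segment a b t) = segment (map f a) (map f b) t := by
  apply Subtype.ext
  exact (map_add (FunOnFinite.linearMap ℝ ℝ f) _ _).trans (by simp only [map_smul]; rfl)

lemma continuous_segment {Z : Type*} [TopologicalSpace Z] {a b : Z → stdSimplex ℝ ι}
    {t : Z → unitInterval} (ha : Continuous a) (hb : Continuous b) (ht : Continuous t) :
    Continuous fun z => segment (a z) (b z) (t z) := by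
  refine Continuous.subtype_mk ?_ _
  have ha' := continuous_subtype_val.comp ha
  have hb' := continuous_subtype_val.comp hb
  have ht' := continuous_subtype_val.comp ht
  exact ((continuous_const.sub ht').smul ha').add (ht'.smul hb')

end stdSimplex

/-! ### Contracting `|S|` along a section of `S_{v/} ⟶ S`. -/

namespace LocCoCart

/-- The segment from the front vertex to a point of the back face of the topological simplex
`⦋0⦌ ⋆ c`. -/
noncomputable def coneSegment (c : SimplexCategory) (w : stdSimplex ℝ (Fin (c.len + 1)))
    (t : unitInterval) : stdSimplex ℝ (Fin ((joinObj ⦋0⦌ c).len + 1)) :=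
  stdSimplex.segment (stdSimplex.map (joinInl ⦋0⦌ c) (stdSimplex.vertex 0))
    (stdSimplex.map (joinInr ⦋0⦌ c) w) t

/-- Affine maps preserve segments, and `𝟙 ⋆ φ` fixes the cone point. This makes the cone paths
compatible with simplicial operators. -/
lemma map_coneSegment {c d : SimplexCategory} (φ : c ⟶ d) (w : stdSimplex ℝ (Fin (c.len + 1)))
    (t : unitInterval) :
    stdSimplex.map (joinMap (𝟙 ⦋0⦌) φ) (coneSegment c w t) =
      coneSegment d (stdSimplex.map φ w) t := by
  have h₁ : (joinMap (𝟙 ⦋0⦌) φ : _ → _) ∘ joinInl ⦋0⦌ c = joinInl ⦋0⦌ d :=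
    congrArg (fun f : ⦋0⦌ ⟶ joinObj ⦋0⦌ d => (f : _ → _)) (joinInl_joinMap (𝟙 ⦋0⦌) φ)
  have h₂ : (joinMap (𝟙 ⦋0⦌) φ : _ → _) ∘ joinInr ⦋0⦌ c = joinInr ⦋0⦌ d ∘ φ :=
    congrArg (fun f : c ⟶ joinObj ⦋0⦌ d => (f : _ → _)) (joinInr_joinMap (𝟙 ⦋0⦌) φ)
  rw [coneSegment, coneSegment, stdSimplex.map_segment, stdSimplex.map_comp_apply,
    stdSimplex.map_comp_apply, stdSimplex.map_comp_apply, Function.comp_def, Function.comp_def,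
    Function.comp_def]
  exact congrArg₂ (fun f g => stdSimplex.segment (stdSimplex.map f _) (stdSimplex.map g w) t) h₁ h₂

lemma continuous_coneSegment (c : SimplexCategory) :
    Continuous fun z : stdSimplex ℝ (Fin (c.len + 1)) × unitInterval =>
      coneSegment c z.1 z.2 :=
  stdSimplex.continuous_segment continuous_const
    ((stdSimplex.continuous_map _).comp continuous_fst) continuous_snd

variable {S : SSet.{u}}

/-- The continuous map `Δᶜ → |S|` attached to a simplex of `S`. -/
noncomputable def realize {c : SimplexCategoryᵒᵖ} (s : S.obj c) :
    C(stdSimplex ℝ (Fin (c.unop.len + 1)), SSet.toTop.obj S) :=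
  TopCat.toSSetObjEquiv _ c ((sSetTopAdj.unit.app S).app c s)

lemma toSSetObjEquiv_app_map {T : TopCat.{u}} (g : S ⟶ TopCat.toSSet.obj T)
    {c d : SimplexCategory} (φ : c ⟶ d) (s : S.obj (op d))
    (w : stdSimplex ℝ (Fin (c.len + 1))) :
    TopCat.toSSetObjEquiv _ (op c) (g.app _ (S.map φ.op s)) w =
      TopCat.toSSetObjEquiv _ (op d) (g.app _ s) (stdSimplex.map φ w) := by
  rw [NatTrans.naturality_apply g φ.op s]
  rfl

lemma realize_map {c d : SimplexCategory} (φ : c ⟶ d) (s : S.obj (op d))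
    (w : stdSimplex ℝ (Fin (c.len + 1))) :
    realize (S.map φ.op s) w = realize s (stdSimplex.map φ w) :=
  toSSetObjEquiv_app_map (sSetTopAdj.unit.app S) φ s w

variable {v : S _⦋0⦌}

/-- The path in `|S|` along the cones given by a section of `S_{v/} ⟶ S`. -/
noncomputable def conePath (e : S ⟶ under S v) {c : SimplexCategoryᵒᵖ} (s : S.obj c) :
    C(stdSimplex ℝ (Fin (c.unop.len + 1)), C(unitInterval, SSet.toTop.obj S)) :=
  ContinuousMap.curry ((realize (e.app c s).1).comp ⟨_, continuous_coneSegment c.unop⟩)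

lemma conePath_apply (e : S ⟶ under S v) {c : SimplexCategoryᵒᵖ} (s : S.obj c)
    (w : stdSimplex ℝ (Fin (c.unop.len + 1))) (t : unitInterval) :
    conePath e s w t = realize (e.app c s).1 (coneSegment c.unop w t) := rfl

/-- The maps `conePath`, as a simplicial map to the singular simplicial set of the path space. -/
noncomputable def coneSSet (e : S ⟶ under S v) :
    S ⟶ TopCat.toSSet.obj (TopCat.of C(unitInterval, SSet.toTop.obj S)) where
  app c := TypeCat.ofHom fun s => (TopCat.toSSetObjEquiv _ c).symm (conePath e s)
  naturality c d φ := by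
    ext s
    apply (TopCat.toSSetObjEquiv _ d).injective
    ext w t
    change conePath e (S.map φ s) w t = conePath e s (stdSimplex.map φ.unop w) t
    rw [conePath_apply, conePath_apply, ← map_coneSegment, ← realize_map]
    congr 2
    rw [NatTrans.naturality_apply]
    rfl

/-- Evaluation of paths at `t`. -/
def evalPath (X : TopCat.{u}) (t : unitInterval) : TopCat.of C(unitInterval, X) ⟶ X :=
  TopCat.ofHom ⟨fun γ => γ t, continuous_eval_const t⟩

/-- A simplicial set `S` such that `S_{v/} ⟶ S` has a section has a contractible realisation. -/
theorem contractibleSpace_of_section (e : S ⟶ under S v) (he : e ≫ underProj S v = 𝟙 S) :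
    ContractibleSpace (SSet.toTop.obj S) := by
  -- By adjunction the simplicial map becomes a continuous map from `|S|` to its path space, so
  -- realisations of products are not needed.
  let K := (sSetTopAdj.homEquiv _ _).symm (coneSSet e)
  have hK (t : unitInterval) :
      sSetTopAdj.homEquiv _ _ (K ≫ evalPath _ t) =
        coneSSet e ≫ TopCat.toSSet.map (evalPath _ t) := by
    rw [Adjunction.homEquiv_naturality_right, Equiv.apply_symm_apply]
  have h₁ : K ≫ evalPath _ 1 = 𝟙 _ := by
    apply (sSetTopAdj.homEquiv _ _).injective
    rw [hK, Adjunction.homEquiv_id]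
    ext c s
    apply (TopCat.toSSetObjEquiv _ c).injective
    ext w
    change conePath e s w 1 = realize s w
    rw [conePath_apply, coneSegment, stdSimplex.segment_one, ← realize_map]
    congr 2
    exact ConcreteCategory.congr_hom (congrArg (fun f : S ⟶ S => f.app c) he) s
  have h₀ : K ≫ evalPath _ 0 = TopCat.const (realize v (stdSimplex.vertex 0)) := by
    apply (sSetTopAdj.homEquiv _ _).injective
    rw [hK, Adjunction.homEquiv_unit]
    ext c s
    apply (TopCat.toSSetObjEquiv _ c).injective
    ext w
    change conePath e s w 0 = realize v (stdSimplex.vertex 0)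
    rw [conePath_apply, coneSegment, stdSimplex.segment_zero, ← realize_map]
    congr 2
    exact (e.app c s).2
  rw [contractible_iff_id_nullhomotopic]
  -- The paths start at the cone point, so the homotopy runs from the constant map to the identity.
  refine ⟨realize v (stdSimplex.vertex 0), ContinuousMap.Homotopic.symm ⟨{
    toFun z := K z.2 z.1
    continuous_toFun := ?_
    map_zero_left y := ConcreteCategory.congr_hom h₀ y
    map_one_left y := ConcreteCategory.congr_hom h₁ y }⟩⟩
  have hc : Continuous fun z : unitInterval × SSet.toTop.obj S => (K.hom z.2, z.1) := by fun_prop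
  exact continuous_eval.comp hc

/-! ### Reassociating joins, and simplices of `Δ[1]`. -/

/-- The reassociation `⦋0⦌ ⋆ (⦋0⦌ ⋆ c) ⟶ ⦋1⦌ ⋆ c`. -/
def joinAssoc (c : SimplexCategory) : joinObj ⦋0⦌ (joinObj ⦋0⦌ c) ⟶ joinObj ⦋1⦌ c :=
  SimplexCategory.Hom.mk ⟨fun i => ⟨i.val, by
    have := i.isLt
    simp only [SimplexCategory.len_mk] at this ⊢
    omega⟩, fun _ _ h => h⟩

lemma joinObj_hom_ext {a c d : SimplexCategory} {f g : joinObj a c ⟶ d}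
    (h₁ : joinInl a c ≫ f = joinInl a c ≫ g) (h₂ : joinInr a c ≫ f = joinInr a c ≫ g) : f = g := by
  ext i : 3
  refine Fin.addCases (m := a.len + 1) (n := c.len + 1) (fun i => ?_) (fun i => ?_) i
  · exact congrArg (fun φ : a ⟶ d => φ.toOrderHom i) h₁
  · exact congrArg (fun φ : c ⟶ d => φ.toOrderHom i) h₂

lemma joinInl_joinAssoc (c : SimplexCategory) :
    joinInl ⦋0⦌ (joinObj ⦋0⦌ c) ≫ joinAssoc c = sourceVertex ≫ joinInl ⦋1⦌ c := by
  ext i : 3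
  fin_cases i
  rfl

lemma joinInl_joinInr_joinAssoc (c : SimplexCategory) :
    joinInl ⦋0⦌ c ≫ joinInr ⦋0⦌ (joinObj ⦋0⦌ c) ≫ joinAssoc c =
      SimplexCategory.δ (0 : Fin 2) ≫ joinInl ⦋1⦌ c := by
  ext i : 3
  fin_cases i
  rfl

lemma joinInr_joinInr_joinAssoc (c : SimplexCategory) :
    joinInr ⦋0⦌ c ≫ joinInr ⦋0⦌ (joinObj ⦋0⦌ c) ≫ joinAssoc c = joinInr ⦋1⦌ c := by
  ext i : 3
  apply Fin.ext
  change 0 + 1 + (0 + 1 + i.val) = 1 + 1 + i.val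
  omega

lemma joinAssoc_naturality {c d : SimplexCategory} (φ : c ⟶ d) :
    joinMap (𝟙 ⦋0⦌) (joinMap (𝟙 ⦋0⦌) φ) ≫ joinAssoc d = joinAssoc c ≫ joinMap (𝟙 ⦋1⦌) φ := by
  apply joinObj_hom_ext
  · rw [← Category.assoc, joinInl_joinMap, Category.id_comp, joinInl_joinAssoc, ← Category.assoc,
      joinInl_joinAssoc, Category.assoc, joinInl_joinMap, Category.id_comp]
  rw [← Category.assoc, joinInr_joinMap, Category.assoc]
  apply joinObj_hom_ext
  · rw [← Category.assoc, joinInl_joinMap, Category.id_comp, joinInl_joinInr_joinAssoc,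
      ← Category.assoc, ← Category.assoc, Category.assoc (joinInl _ _), joinInl_joinInr_joinAssoc,
      Category.assoc, joinInl_joinMap, Category.id_comp]
  · rw [← Category.assoc, joinInr_joinMap, Category.assoc, joinInr_joinInr_joinAssoc,
      ← Category.assoc, ← Category.assoc, Category.assoc (joinInr _ _), joinInr_joinInr_joinAssoc,
      joinInr_joinMap]

lemma joinMap_joinInl_joinAssoc (c : SimplexCategory) :
    joinMap (𝟙 ⦋0⦌) (joinInl ⦋0⦌ c) ≫ joinAssoc c = joinInl ⦋1⦌ c := by
  ext i : 3
  change Fin 2 at i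
  fin_cases i <;> rfl

/-- Both sides omit the vertex `1` of the front edge: projecting away the cone point `f` leaves `x`
followed by the back face. -/
lemma joinMap_joinInr_joinAssoc (c : SimplexCategory) :
    joinMap (𝟙 ⦋0⦌) (joinInr ⦋0⦌ c) ≫ joinAssoc c = joinMap sourceVertex (𝟙 c) := by
  apply joinObj_hom_ext
  · rw [← Category.assoc, joinInl_joinMap, Category.id_comp, joinInl_joinAssoc, joinInl_joinMap]
  · rw [← Category.assoc, joinInr_joinMap, Category.assoc, joinInr_joinInr_joinAssoc,
      joinInr_joinMap, Category.id_comp]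

lemma joinInl_zero_zero : joinInl ⦋0⦌ ⦋0⦌ = sourceVertex := by
  ext i : 3
  fin_cases i
  rfl

/-- The retraction `⦋1⦌ ⋆ c ⟶ ⦋1⦌` of the front face. -/
def joinRetract (c : SimplexCategory) : joinObj ⦋1⦌ c ⟶ ⦋1⦌ :=
  SimplexCategory.Hom.mk ⟨fun i => ⟨min i.val 1, by simp⟩, fun i j h => by
    simp only [Fin.le_def] at h ⊢
    omega⟩

lemma joinInl_joinRetract (c : SimplexCategory) : joinInl ⦋1⦌ c ≫ joinRetract c = 𝟙 ⦋1⦌ := by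
  ext i : 3
  fin_cases i <;> rfl

lemma stdSimplex_ext_join {m : ℕ} {a c : SimplexCategory}
    {y y' : (Δ[m] : SSet.{u}).obj (op (joinObj a c))}
    (h₁ : (Δ[m] : SSet.{u}).map (joinInl a c).op y = (Δ[m] : SSet.{u}).map (joinInl a c).op y')
    (h₂ : (Δ[m] : SSet.{u}).map (joinInr a c).op y = (Δ[m] : SSet.{u}).map (joinInr a c).op y') :
    y = y' :=
  SSet.stdSimplex.objEquiv.injective (joinObj_hom_ext
    (congrArg SSet.stdSimplex.objEquiv h₁) (congrArg SSet.stdSimplex.objEquiv h₂))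

/-- By monotonicity, all vertices after one with value `1` have value `1`. -/
lemma map_joinInr_eq_const {c : SimplexCategory}
    {γ : (Δ[1] : SSet.{u}).obj (op (joinObj ⦋1⦌ c))} {τ : (Δ[1] : SSet.{u}) _⦋1⦌}
    (hγ : (Δ[1] : SSet.{u}).map (joinInl ⦋1⦌ c).op γ = τ) (hτ : τ 1 = 1) :
    (Δ[1] : SSet.{u}).map (joinInr ⦋1⦌ c).op γ = SSet.stdSimplex.const 1 1 _ := by
  apply SSet.stdSimplex.objEquiv.injective
  ext j : 3
  refine Fin.last_le_iff.1 (le_trans (le_of_eq ?_) ((SSet.stdSimplex.objEquiv γ).toOrderHom.monotone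
    (a := (joinInl ⦋1⦌ c).toOrderHom 1) ?_))
  · subst hγ
    exact hτ.symm
  · rw [Fin.le_def]
    change 1 ≤ 1 + 1 + j.val
    omega

/-! ### CoCartesian edges over `Δ[1]`. -/

variable {Z : SSet.{u}}

/-- For `q : Z ⟶ Δ[1]`, the subcomplex of `Z_{z/}` of simplices whose projection to `Z` lies over
the vertex `1`. -/
def overOne (q : Z ⟶ Δ[1]) (z : Z _⦋0⦌) : (under Z z).Subcomplex where
  obj c := {g | q.app c ((underProj Z z).app c g) = SSet.stdSimplex.const 1 1 c}
  map {c d} φ g hg := by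
    change q.app d ((underProj Z z).app d ((under Z z).map φ g)) = _
    rw [NatTrans.naturality_apply (underProj Z z), NatTrans.naturality_apply q]
    exact congrArg ((Δ[1] : SSet.{u}).map φ) hg

/-- The tautological edge of `Δ[1]`. -/
abbrev tautEdge : (Δ[1] : SSet.{u}) _⦋1⦌ := SSet.stdSimplex.objEquiv.symm (𝟙 ⦋1⦌)

/-- The front face is prescribed and the back face must be constant at `1`. A `Fact` is used since
`τ` will be `q f`, which is only propositionally the tautological edge. -/
instance subsingleton_under_tautEdge {τ : (Δ[1] : SSet.{u}) _⦋1⦌} [h : Fact (τ = tautEdge)]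
    (c : SimplexCategoryᵒᵖ) :
    Subsingleton ((under (Δ[1] : SSet.{u}) τ).obj c) := by
  obtain rfl := h.out
  exact ⟨fun γ γ' => Subtype.ext <| stdSimplex_ext_join (γ.2.trans γ'.2.symm) <|
    (map_joinInr_eq_const γ.2 rfl).trans (map_joinInr_eq_const γ'.2 rfl).symm⟩

/-- The unique map to `Δ[1]_{τ/}`, where `τ` is the tautological edge. -/
def toUnderTautEdge (S : SSet.{u}) {τ : (Δ[1] : SSet.{u}) _⦋1⦌} [Fact (τ = tautEdge)] :
    S ⟶ under (Δ[1] : SSet.{u}) τ where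
  app c := TypeCat.ofHom fun _ => ⟨(Δ[1] : SSet.{u}).map (joinRetract c.unop).op τ, by
    rw [map_map_apply, joinInl_joinRetract]
    exact SSet.stdSimplex.ext _ _ fun _ => rfl⟩
  naturality _ _ _ := by
    ext
    exact Subsingleton.elim _ _

/-- Both composites send every simplex to the one with vertices `(0, 1, …, 1)`. This supplies the
map from `overOne` to the target of the coCartesian comparison. -/
lemma comp_toUnderTautEdge {q : Z ⟶ Δ[1]} {f : Z _⦋1⦌} [hf : Fact (q.app _ f = tautEdge)] :
    ((overOne q (source f)).ι ≫ underMap q (source_app q f)) =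
      toUnderTautEdge _ ≫ underRestrict (Δ[1] : SSet.{u}) sourceVertex
        (rfl : _ = source (q.app _ f)) := by
  ext c g
  apply Subtype.ext
  apply stdSimplex_ext_join
  · exact (((overOne q (source f)).ι ≫ underMap q (source_app q f)).app c g).2.trans
      ((toUnderTautEdge (overOne q (source f)).toSSet ≫ underRestrict (Δ[1] : SSet.{u})
        sourceVertex (rfl : _ = source (q.app _ f))).app c g).2.symm
  · refine (NatTrans.naturality_apply q (joinInr ⦋0⦌ c.unop).op g.1.1).symm.trans (g.2.trans ?_)
    change _ = (Δ[1] : SSet.{u}).map (joinInr ⦋0⦌ c.unop).op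
      ((Δ[1] : SSet.{u}).map (joinMap sourceVertex (𝟙 c.unop)).op
        ((toUnderTautEdge (τ := q.app _ f) (overOne q (source f)).toSSet).app c g).1)
    rw [map_map_apply, joinInr_joinMap, Category.id_comp]
    refine (map_joinInr_eq_const
      ((toUnderTautEdge (τ := q.app _ f) (overOne q (source f)).toSSet).app c g).2 ?_).symm
    rw [hf.out]
    rfl

lemma IsTrivialKanFibration.exists_lift {X Y S : SSet.{u}} {p : X ⟶ Y}
    (hp : IsTrivialKanFibration p) (g : S ⟶ Y) : ∃ s : S ⟶ X, s ≫ p = g := by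
  -- Boundary inclusions generate all monomorphisms, so `p` lifts against `∅ ⟶ S`.
  have h : (MorphismProperty.monomorphisms SSet.{u}).rlp p := by
    rw [SSet.rlp_monomorphisms]
    rintro _ _ _ ⟨n⟩
    exact hp n
  have : HasLiftingProperty ((⊥ : S.Subcomplex).ι) p :=
    h _ (MorphismProperty.monomorphisms.infer_property _)
  have sq : CommSq (default : ((⊥ : S.Subcomplex) : SSet.{u}) ⟶ X) (⊥ : S.Subcomplex).ι p g :=
    ⟨Subsingleton.elim _ _⟩
  exact ⟨sq.lift, sq.fac_right⟩

variable {q : Z ⟶ Δ[1]} {f : Z _⦋1⦌}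

lemma IsCoCartesianEdge.exists_lift (hf : IsCoCartesianEdge q f) (h : q.app _ f = tautEdge) :
    ∃ s : (overOne q (source f)).toSSet ⟶ under Z f,
      s ≫ underRestrict Z sourceVertex rfl = (overOne q (source f)).ι := by
  have : Fact (q.app _ f = tautEdge) := ⟨h⟩
  obtain ⟨s, hs⟩ := IsTrivialKanFibration.exists_lift hf
    (pullback.lift (overOne q (source f)).ι (toUnderTautEdge _) comp_toUnderTautEdge)
  refine ⟨s, ?_⟩
  have h₁ : coCartesianComparison q f ≫ pullback.fst _ _ = underRestrict Z sourceVertex rfl :=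
    pullback.lift_fst _ _ _
  rw [← h₁, ← Category.assoc, hs]
  exact pullback.lift_fst _ _ _

/-- An edge over the tautological edge of `Δ[1]`, as a vertex of `overOne`. -/
def overOneVertex (h : q.app _ f = tautEdge) : (overOne q (source f)).toSSet _⦋0⦌ :=
  ⟨⟨f, congrArg (fun θ : ⦋0⦌ ⟶ ⦋1⦌ => Z.map θ.op f) joinInl_zero_zero⟩, by
    change q.app _ (Z.map (joinInr ⦋0⦌ ⦋0⦌).op f) = _
    rw [NatTrans.naturality_apply q]
    refine (congrArg ((Δ[1] : SSet.{u}).map (joinInr ⦋0⦌ ⦋0⦌).op) h).trans ?_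
    apply SSet.stdSimplex.objEquiv.injective
    ext j : 3
    fin_cases j
    rfl⟩

lemma underProj_app_joinAssoc_mem (h : q.app _ f = tautEdge) {c : SimplexCategoryᵒᵖ}
    (g : (under Z f).obj c) :
    q.app _ (Z.map (joinInr ⦋0⦌ _).op (Z.map (joinAssoc c.unop).op g.1)) =
      SSet.stdSimplex.const 1 1 _ := by
  have h₀ : (Δ[1] : SSet.{u}).map (joinInl ⦋1⦌ c.unop).op (q.app _ g.1) = tautEdge := by
    rw [← NatTrans.naturality_apply q, g.2, h]
  rw [map_map_apply, NatTrans.naturality_apply q]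
  apply stdSimplex_ext_join
  · rw [map_map_apply, joinInl_joinInr_joinAssoc, ← map_map_apply, h₀]
    apply SSet.stdSimplex.objEquiv.injective
    ext j : 3
    fin_cases j
    rfl
  · rw [map_map_apply, joinInr_joinInr_joinAssoc]
    exact map_joinInr_eq_const h₀ rfl

/-- The simplicial set `Z_{f/}` maps to the under-category of `overOne` at the vertex `f`. -/
def underToUnderOverOne (h : q.app _ f = tautEdge) :
    under Z f ⟶ under (overOne q (source f)).toSSet (overOneVertex h) where
  app c := TypeCat.ofHom fun g => ⟨⟨⟨Z.map (joinAssoc c.unop).op g.1, by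
      rw [map_map_apply, joinInl_joinAssoc, ← map_map_apply, g.2]⟩,
      underProj_app_joinAssoc_mem h g⟩, by
    apply Subtype.ext
    apply Subtype.ext
    change Z.map (joinMap (𝟙 ⦋0⦌) (joinInl ⦋0⦌ c.unop)).op (Z.map (joinAssoc c.unop).op g.1) = f
    rw [map_map_apply, joinMap_joinInl_joinAssoc, g.2]⟩
  naturality c d φ := by
    ext g
    apply Subtype.ext
    apply Subtype.ext
    apply Subtype.ext
    change Z.map (joinAssoc d.unop).op (Z.map (joinMap (𝟙 ⦋1⦌) φ.unop).op g.1) =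
      Z.map (joinMap (𝟙 ⦋0⦌) (joinMap (𝟙 ⦋0⦌) φ.unop)).op (Z.map (joinAssoc c.unop).op g.1)
    rw [map_map_apply, map_map_apply, joinAssoc_naturality]

/-- Ensures that a lift to `Z_{f/}` of the inclusion of `overOne` yields a section of the
projection. -/
lemma underToUnderOverOne_underProj (h : q.app _ f = tautEdge) :
    underToUnderOverOne h ≫ underProj _ _ ≫ (overOne q (source f)).ι =
      underRestrict Z sourceVertex rfl := by
  ext c g
  apply Subtype.ext
  change Z.map (joinMap (𝟙 ⦋0⦌) (joinInr ⦋0⦌ c.unop)).op (Z.map (joinAssoc c.unop).op g.1) =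
    Z.map (joinMap sourceVertex (𝟙 c.unop)).op g.1
  rw [map_map_apply, joinMap_joinInr_joinAssoc]

/-- If `f : x ⟶ y` is coCartesian for `q : Z ⟶ Δ[1]` and lies over the edge `0 ⟶ 1`, then the part
of `Z_{x/}` over the vertex `1` has a contractible realisation. -/
theorem IsCoCartesianEdge.contractibleSpace_overOne (hf : IsCoCartesianEdge q f)
    (h : q.app _ f = tautEdge) :
    ContractibleSpace (SSet.toTop.obj (overOne q (source f)).toSSet) := by
  obtain ⟨s, hs⟩ := hf.exists_lift h
  refine contractibleSpace_of_section (s ≫ underToUnderOverOne h) ?_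
  rw [← cancel_mono (overOne q (source f)).ι, Category.assoc, Category.assoc,
    underToUnderOverOne_underProj, hs, Category.id_comp]

/-! ### Comparing the fibre over the last vertex with `X_{|σ}`. -/

/-- The simplex of a fibre product given by a pair of simplices. -/
noncomputable def pullbackMk {X Y B : SSet.{u}} (p : X ⟶ B) (r : Y ⟶ B) {c : SimplexCategory}
    (a : X.obj (op c)) (b : Y.obj (op c)) (h : p.app _ a = r.app _ b) :
    (pullback p r).obj (op c) :=
  SSet.yonedaEquiv (pullback.lift (SSet.yonedaEquiv.symm a) (SSet.yonedaEquiv.symm b) (by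
    rw [SSet.yonedaEquiv_symm_comp, SSet.yonedaEquiv_symm_comp, h]))

section

variable {X Y B : SSet.{u}} {p : X ⟶ B} {r : Y ⟶ B} {c : SimplexCategory}

@[simp]
lemma fst_pullbackMk (a : X.obj (op c)) (b : Y.obj (op c)) (h : p.app _ a = r.app _ b) :
    (pullback.fst p r).app _ (pullbackMk p r a b h) = a := by
  rw [pullbackMk, ← SSet.yonedaEquiv_comp, pullback.lift_fst, Equiv.apply_symm_apply]

@[simp]
lemma snd_pullbackMk (a : X.obj (op c)) (b : Y.obj (op c)) (h : p.app _ a = r.app _ b) :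
    (pullback.snd p r).app _ (pullbackMk p r a b h) = b := by
  rw [pullbackMk, ← SSet.yonedaEquiv_comp, pullback.lift_snd, Equiv.apply_symm_apply]

lemma pullback_ext {z z' : (pullback p r).obj (op c)}
    (h₁ : (pullback.fst p r).app _ z = (pullback.fst p r).app _ z')
    (h₂ : (pullback.snd p r).app _ z = (pullback.snd p r).app _ z') : z = z' := by
  apply SSet.yonedaEquiv.symm.injective
  apply pullback.hom_ext
  · rw [SSet.yonedaEquiv_symm_comp, SSet.yonedaEquiv_symm_comp, h₁]
  · rw [SSet.yonedaEquiv_symm_comp, SSet.yonedaEquiv_symm_comp, h₂]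

end

variable {n : ℕ} {X : SSet.{u}} {p : X ⟶ Δ[n]}

lemma restrProj_liftRestr {m : ℕ} (f : X _⦋m⦌) :
    (restrProj p (p.app _ f)).app _ (liftRestr p f) = f := by
  rw [liftRestr, ← SSet.yonedaEquiv_comp, pullback.lift_fst, Equiv.apply_symm_apply]

lemma restrMap_liftRestr (f : X _⦋1⦌) :
    (restrMap p (p.app _ f)).app _ (liftRestr p f) = tautEdge := by
  rw [liftRestr, ← SSet.yonedaEquiv_comp, pullback.lift_snd]
  rfl

lemma restrProj_source (f : X _⦋1⦌) :
    (restrProj p (p.app _ f)).app _ (source (liftRestr p f)) = source f := by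
  rw [source_app, restrProj_liftRestr]

/-- The part of `X_{x/}` over the last vertex. -/
noncomputable abbrev fibreUnder (p : X ⟶ Δ[n]) (x : X _⦋0⦌) : SSet.{u} :=
  pullback (restrProj p (lastVertex n)) (underProj X x)

lemma app_underProj_fibreUnder {x : X _⦋0⦌} {c : SimplexCategoryᵒᵖ} (z : (fibreUnder p x).obj c) :
    p.app _ ((underProj X x).app _ ((pullback.snd _ (underProj X x)).app c z)) =
      SSet.stdSimplex.const n (Fin.last n) c := by
  have h : pullback.snd (restrProj p (lastVertex n)) (underProj X x) ≫ underProj X x ≫ p =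
      (pullback.fst _ _ ≫ pullback.snd _ _) ≫ SSet.yonedaEquiv.symm (lastVertex n) := by
    rw [← pullback.condition_assoc, pullback.condition, Category.assoc]
  exact ConcreteCategory.congr_hom (congrArg (fun f : fibreUnder p x ⟶ Δ[n] => f.app c) h) z

lemma const_joinInl (c : SimplexCategory) :
    joinInl ⦋0⦌ c ≫ joinMap (𝟙 ⦋0⦌) (SimplexCategory.const c ⦋0⦌ 0) = sourceVertex := by
  rw [joinInl_joinMap, Category.id_comp, joinInl_zero_zero]

/-- Such a simplex lies over `(p x, n, …, n)`, the image under the edge `p f` of `(0, 1, …, 1)`.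
Prescribing the latter as the `Δ[1]`-coordinate works even when `p f` is degenerate. -/
lemma app_eq_map_joinMap {f : X _⦋1⦌} (hf : (p.app _ f) 1 = Fin.last n) {c : SimplexCategoryᵒᵖ}
    (z : (fibreUnder p (source f)).obj c) :
    p.app _ ((pullback.snd _ (underProj X (source f))).app c z).1 =
      (SSet.yonedaEquiv.symm (p.app _ f)).app _ (SSet.stdSimplex.objEquiv.symm
        (joinMap (𝟙 ⦋0⦌) (SimplexCategory.const c.unop ⦋0⦌ 0))) := by
  apply stdSimplex_ext_join
  · rw [← NatTrans.naturality_apply p, ((pullback.snd _ (underProj X (source f))).app c z).2,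
      ← NatTrans.naturality_apply (SSet.yonedaEquiv.symm (p.app _ f)),
      SSet.stdSimplex.map_objEquiv_symm, Quiver.Hom.unop_op, const_joinInl, source_app]
    rfl
  · rw [← NatTrans.naturality_apply p]
    rw [← NatTrans.naturality_apply (SSet.yonedaEquiv.symm (p.app _ f)),
      SSet.stdSimplex.map_objEquiv_symm, Quiver.Hom.unop_op, joinInr_joinMap]
    refine (app_underProj_fibreUnder z).trans ?_
    apply SSet.stdSimplex.objEquiv.injective
    ext j : 3
    exact hf.symm

/-- The simplex of `X_{|σ}` attached to a simplex of `X_{x/}` over the last vertex, where `σ` is an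
edge from `p x` to the last vertex. -/
noncomputable def restrSimplex {f : X _⦋1⦌} (hf : (p.app _ f) 1 = Fin.last n)
    {c : SimplexCategoryᵒᵖ} (z : (fibreUnder p (source f)).obj c) :
    (restr p (p.app _ f)).obj (op (joinObj ⦋0⦌ c.unop)) :=
  pullbackMk _ _ ((pullback.snd _ (underProj X (source f))).app c z).1
    (SSet.stdSimplex.objEquiv.symm (joinMap (𝟙 ⦋0⦌) (SimplexCategory.const c.unop ⦋0⦌ 0)))
    (app_eq_map_joinMap hf z)

lemma restrSimplex_front {f : X _⦋1⦌} (hf : (p.app _ f) 1 = Fin.last n)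
    {c : SimplexCategoryᵒᵖ} (z : (fibreUnder p (source f)).obj c) :
    (restr p (p.app _ f)).map (joinInl ⦋0⦌ c.unop).op (restrSimplex hf z) =
      source (liftRestr p f) := by
  apply pullback_ext
  · rw [NatTrans.naturality_apply, restrSimplex, fst_pullbackMk, restrProj_source]
    exact ((pullback.snd _ (underProj X (source f))).app c z).2
  · rw [NatTrans.naturality_apply, restrSimplex, snd_pullbackMk, source_app, restrMap_liftRestr,
      SSet.stdSimplex.map_objEquiv_symm, Quiver.Hom.unop_op, const_joinInl]
    rfl

/-- The comparison map from the part of `X_{x/}` over the last vertex to the corresponding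
simplicial set for `X_{|σ}`, where `σ` is an edge from `p x` to the last vertex. -/
noncomputable def fibreUnderToOverOne {f : X _⦋1⦌} (hf : (p.app _ f) 1 = Fin.last n) :
    fibreUnder p (source f) ⟶
      (overOne (restrMap p (p.app _ f)) (source (liftRestr p f))).toSSet where
  app c := TypeCat.ofHom fun z => ⟨⟨restrSimplex hf z, restrSimplex_front hf z⟩, by
    change (restrMap p (p.app _ f)).app _ ((restr p (p.app _ f)).map (joinInr ⦋0⦌ c.unop).op
      (restrSimplex hf z)) = _
    rw [NatTrans.naturality_apply, restrSimplex, snd_pullbackMk, SSet.stdSimplex.map_objEquiv_symm,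
      Quiver.Hom.unop_op, joinInr_joinMap]
    apply SSet.stdSimplex.objEquiv.injective
    ext j : 3
    rfl⟩
  naturality c d φ := by
    ext z
    apply Subtype.ext
    apply Subtype.ext
    change restrSimplex hf ((fibreUnder p (source f)).map φ z) =
      (restr p (p.app _ f)).map (joinMap (𝟙 ⦋0⦌) φ.unop).op (restrSimplex hf z)
    apply pullback_ext
    · rw [NatTrans.naturality_apply, restrSimplex, restrSimplex, fst_pullbackMk, fst_pullbackMk,
        NatTrans.naturality_apply]
      rfl
    · rw [NatTrans.naturality_apply, restrSimplex, restrSimplex, snd_pullbackMk, snd_pullbackMk,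
        SSet.stdSimplex.map_objEquiv_symm, Quiver.Hom.unop_op, ← joinMap_comp]
      rfl

lemma overOne_comp_eq_const {f : X _⦋1⦌} (hf : (p.app _ f) 1 = Fin.last n) :
    ((overOne (restrMap p (p.app _ f)) (source (liftRestr p f))).ι ≫ underProj _ _ ≫
      restrProj p (p.app _ f)) ≫ p =
      (SSet.const (SSet.stdSimplex.obj₀Equiv.symm 0) :
        (overOne (restrMap p (p.app _ f)) (source (liftRestr p f))).toSSet ⟶ Δ[0]) ≫
        SSet.yonedaEquiv.symm (lastVertex n) := by
  rw [Category.assoc, Category.assoc, pullback.condition]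
  ext c g
  change (SSet.yonedaEquiv.symm (p.app _ f)).app c ((restrMap p (p.app _ f)).app c
    ((underProj (restr p (p.app _ f)) (source (liftRestr p f))).app c g.1)) = _
  rw [show (restrMap p (p.app _ f)).app c
    ((underProj (restr p (p.app _ f)) (source (liftRestr p f))).app c g.1) = _ from g.2]
  apply SSet.stdSimplex.objEquiv.injective
  ext j : 3
  exact hf

lemma overOne_comp_underMap (f : X _⦋1⦌) :
    ((overOne (restrMap p (p.app _ f)) (source (liftRestr p f))).ι ≫ underProj _ _ ≫
      restrProj p (p.app _ f)) =
    ((overOne (restrMap p (p.app _ f)) (source (liftRestr p f))).ι ≫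
      underMap (restrProj p (p.app _ f)) (restrProj_source f)) ≫ underProj X (source f) := by
  ext c g
  exact NatTrans.naturality_apply (restrProj p (p.app _ f)) (joinInr ⦋0⦌ c.unop).op g.1.1

/-- The map in the direction opposite to `fibreUnderToOverOne`. -/
noncomputable def overOneToFibreUnder {f : X _⦋1⦌} (hf : (p.app _ f) 1 = Fin.last n) :
    (overOne (restrMap p (p.app _ f)) (source (liftRestr p f))).toSSet ⟶
      fibreUnder p (source f) :=
  pullback.lift (pullback.lift _ _ (overOne_comp_eq_const hf)) _
    ((pullback.lift_fst _ _ _).trans (overOne_comp_underMap f))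

lemma fibreUnderToOverOne_comp_overOneToFibreUnder {f : X _⦋1⦌}
    (hf : (p.app _ f) 1 = Fin.last n) :
    fibreUnderToOverOne hf ≫ overOneToFibreUnder hf = 𝟙 (fibreUnder p (source f)) := by
  have h : (fibreUnderToOverOne hf ≫ overOneToFibreUnder hf) ≫ pullback.snd _ _ =
      𝟙 (fibreUnder p (source f)) ≫ pullback.snd _ _ := by
    rw [Category.assoc, overOneToFibreUnder, pullback.lift_snd, Category.id_comp]
    ext c z
    apply Subtype.ext
    exact fst_pullbackMk _ _ (app_eq_map_joinMap hf z)
  -- The fibre coordinate is forced: its component in `X` by the pullback condition and `h`, its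
  -- component in `Δ[0]` by terminality.
  apply pullback.hom_ext _ h
  apply pullback.hom_ext
  · rw [Category.assoc, Category.assoc, pullback.condition, ← Category.assoc, ← Category.assoc, h,
      Category.id_comp, Category.id_comp, pullback.condition]
  · exact SSet.stdSimplex.isTerminalObj₀.hom_ext _ _

end LocCoCart

/-! ### Conclusion. -/

/-- A retract of a contractible space is contractible. -/
lemma ContractibleSpace.of_retract {A B : Type*} [TopologicalSpace A] [TopologicalSpace B]
    [ContractibleSpace B] (i : C(A, B)) (r : C(B, A)) (h : r.comp i = ContinuousMap.id A) :
    ContractibleSpace A := by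
  rw [contractible_iff_id_nullhomotopic, ← h]
  exact ((id_nullhomotopic B).comp_right r).comp_left i

namespace LocCoCart

lemma isWeaklyContractible_of_contractibleSpace {S : SSet.{u}}
    [ContractibleSpace (SSet.toTop.obj S)] : IsWeaklyContractible S :=
  ⟨inferInstance, fun k x => HomotopyGroup.subsingleton_of_contractibleSpace (Fin k) _ x⟩

end LocCoCart

theorem mainTheorem6 (n : ℕ) (X : SSet.{u}) (p : X ⟶ Δ[n])
    (hp : LocCoCart.IsLocallyCoCartesianFibration p) (x : X _⦋0⦌) :
    LocCoCart.IsWeaklyContractible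
      (pullback (LocCoCart.restrProj p (LocCoCart.lastVertex n)) (LocCoCart.underProj X x)) := by
  -- One lift suffices, over the edge from `p x` directly to the last vertex.
  obtain ⟨f, rfl, hf, hcc⟩ := hp.exists_lift
    (SSet.stdSimplex.edge n ((p.app _ x) 0) (Fin.last n) (Fin.le_last _)) x (by
      apply SSet.stdSimplex.objEquiv.injective
      ext j : 3
      fin_cases j
      rfl)
  have hf₁ : (p.app _ f) 1 = Fin.last n := by
    rw [hf]
    rfl
  have := hcc.contractibleSpace_overOne (LocCoCart.restrMap_liftRestr f)
  have : ContractibleSpace (SSet.toTop.obj (LocCoCart.fibreUnder p (LocCoCart.source f))) := by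
    refine ContractibleSpace.of_retract
      (SSet.toTop.map (LocCoCart.fibreUnderToOverOne hf₁)).hom
      (SSet.toTop.map (LocCoCart.overOneToFibreUnder hf₁)).hom ?_
    rw [← TopCat.hom_comp, ← Functor.map_comp,
      LocCoCart.fibreUnderToOverOne_comp_overOneToFibreUnder, CategoryTheory.Functor.map_id]
    rfl
  exact LocCoCart.isWeaklyContractible_of_contractibleSpace
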